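/- Decision trees are binary trees over an input domain $\mathcal X$ whose internal nodes carry boolean functions on $\mathcal X$ and which predict, for $x\in\mathcal X$, the label in $[c]=\{1,\dots,c\}$ of the leaf to which $x$ is routed; every node carries a label, used for prediction when the node is a leaf (in particular when the branch below it has been pruned). The size of a tree is its number of internal nodes. A problem instance is a dataset $D=(X_i,y_i)_{i=1}^n\in(\mathcal X\times[c])^n$, and $L(T,D)=\frac1n\sum_{i=1}^n \mathbf 1[T(X_i)\neq y_i]$. Let $D\mapsto T(D)$ be any rule that assigns to each instance an (unpruned) tree of size at most $t$, where $t\ge 1$. For $\tilde\alpha\ge 0$, minimum cost-complexity pruning replaces $T(D)$ by a tree $T_{\tilde\alpha}(D)$ that minimizes $$L(T',D)+\tilde\alpha\,|\mathrm{leaves}(T')|$$ over all trees $T'$ obtained from $T(D)$ by replacing some (possibly none) of its branches by leaves; ties are broken in an arbitrary fixed way, and $D\mapsto L(T_{\tilde\alpha}(D),D)$ is assumed to be measurable for each $\tilde\alpha\ge 0$. **Theorem.** There is an absolute constant $C>0$ such that, for all such data, every $\epsilon,\delta>0$, every probability distribution $\mathcal D$ over problem instances with $n$ examples, and every integer $$N\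 \ge\ \frac{C}{\epsilon^2}\Big(\log t+\log\frac1\delta\Big),\qquad N\ge 0,$$ the following holds with probability at least $1-\delta$ over independent $D_1,\dots,D_N\sim\mathcal D$: every parameter $\hat\alpha\ge 0$ learned by empirical risk minimization, i.e. every minimizer $\hat\alpha$ of $\sum_{j=1}^N L(T_{\tilde\alpha}(D_j),D_j)$ over $\tilde\alpha\in[0,\infty)$, is $\epsilon$-optimal: $$\mathbb E_{D\sim\mathcal D}\,L(T_{\hat\alpha}(D),D)\ \le\ \mathbb E_{D\sim\mathcal D}\,L(T_{\tilde\alpha}(D),D)+\epsilon\qquad\text{for all }\tilde\alpha\ge 0.$$ -/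

import Mathlib

open MeasureTheory

noncomputable section

/-- Binary decision trees over the input domain `𝒳` with classes `Y`. An internal node carries a
boolean node function (`false`: go left, `true`: go right). Every node, internal or not, carries a
class: the one predicted at that node when it is a leaf, so the class carried by an internal node is
the label which that node gets if the branch below it is pruned away (in practice, the most common
label among the examples that reach the node; any choice is allowed here). -/
inductive DecisionTree (𝒳 Y : Type*) where
  | leaf (label : Y) : DecisionTree 𝒳 Y
  | node (label : Y) (f : 𝒳 → Bool) (left right : DecisionTree 𝒳 Y) : DecisionTree 𝒳 Y

namespace DecisionTree

variable {𝒳 Y : Type*}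

/-- The prediction `T(x)`: the label of the leaf to which `x` is routed. -/
def predict : DecisionTree 𝒳 Y → 𝒳 → Y
  | leaf a, _ => a
  | node _ f l r, x => if f x then r.predict x else l.predict x

/-- The number of leaves. -/
def numLeaves : DecisionTree 𝒳 Y → ℕ
  | leaf _ => 1
  | node _ _ l r => l.numLeaves + r.numLeaves

/-- The size of a tree: its number of internal nodes. -/
def size : DecisionTree 𝒳 Y → ℕ
  | leaf _ => 0
  | node _ _ l r => l.size + r.size + 1

/-- `IsPruning T' T`: the tree `T'` is a pruned subtree of `T`, that is, it has the same root as `T`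
and arises from `T` by replacing some (possibly none) of its branches by leaves. -/
inductive IsPruning : DecisionTree 𝒳 Y → DecisionTree 𝒳 Y → Prop
  | leaf (a : Y) : IsPruning (leaf a) (leaf a)
  | collapse (a : Y) (f : 𝒳 → Bool) (l r : DecisionTree 𝒳 Y) :
      IsPruning (DecisionTree.leaf a) (node a f l r)
  | node (a : Y) (f : 𝒳 → Bool) {l' r' l r : DecisionTree 𝒳 Y} :
      IsPruning l' l → IsPruning r' r → IsPruning (node a f l' r') (node a f l r)

end DecisionTree

/-- A problem instance: a dataset of `n` examples, each one labeled by one of `c` classes. -/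
abbrev Dataset (𝒳 : Type*) (c n : ℕ) : Type _ := Fin n → 𝒳 × Fin c

section Pruning

variable {𝒳 : Type*} {c n : ℕ}

/-- The 0-1 loss `L(T, D)`: the fraction of the examples of `D` that `T` misclassifies. -/
def treeLoss (T : DecisionTree 𝒳 (Fin c)) (D : Dataset 𝒳 c n) : ℝ :=
  (1 / (n : ℝ)) * ∑ i : Fin n, if T.predict (D i).1 ≠ (D i).2 then 1 else 0

/-- The cost-complexity `R(T, D) = L(T, D) + α |leaves(T)|`. -/
def costComplexity (α : ℝ) (T : DecisionTree 𝒳 (Fin c)) (D : Dataset 𝒳 c n) : ℝ :=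
  treeLoss T D + α * T.numLeaves

/-- `prune` is a minimum cost-complexity pruning algorithm: for every `α ≥ 0`, every tree `T` and
every dataset `D`, the tree `prune α T D` minimizes the cost-complexity on `D` among all pruned
subtrees of `T`. Ties may be broken in any way. -/
def IsMinCostComplexityPruning
    (prune : ℝ → DecisionTree 𝒳 (Fin c) → Dataset 𝒳 c n → DecisionTree 𝒳 (Fin c)) : Prop :=
  ∀ α : ℝ, 0 ≤ α → ∀ (T : DecisionTree 𝒳 (Fin c)) (D : Dataset 𝒳 c n),
    (prune α T D).IsPruning T ∧
      ∀ T' : DecisionTree 𝒳 (Fin c), T'.IsPruning T →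
        costComplexity α (prune α T D) D ≤ costComplexity α T' D

end Pruning

section Learning

variable {Ω : Type*}

/-- `α` is a parameter in `[0, ∞)` learned by empirical risk minimization on the sample
`S 0, …, S (N - 1)`, where `ℓ α D` is the loss of the parameter `α` on the instance `D`. -/
def IsERM (ℓ : ℝ → Ω → ℝ) {N : ℕ} (S : Fin N → Ω) (α : ℝ) : Prop :=
  0 ≤ α ∧ ∀ α' : ℝ, 0 ≤ α' → ∑ j, ℓ α (S j) ≤ ∑ j, ℓ α' (S j)

/-- The expected loss of `α` is at most `ε` larger than that of every parameter in `[0, ∞)`. -/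
def IsEpsOptimal [MeasurableSpace Ω] (ℓ : ℝ → Ω → ℝ) (μ : Measure Ω) (ε α : ℝ) : Prop :=
  ∀ α' : ℝ, 0 ≤ α' → ∫ D, ℓ α D ∂μ ≤ ∫ D, ℓ α' D ∂μ + ε

end Learning

end

section CostComplexity

variable {𝒳 : Type*} {c n : ℕ}

/-! Raising the parameter only prunes more, so the training loss is nondecreasing in it
(`treeLoss_mono`). Hence `0` minimizes both the empirical and the expected loss, and an empirical
minimizer `α` must agree in loss with `0` on every sampled instance. If `α` is not `ε`-optimal,
losses in `[0, 1]` force disagreement with probability more than `ε`, so agreement on all `N`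
samples has probability at most `(1 - ε) ^ N`. By monotonicity the agreement events are nested in
`α`, so passing to all bad `α` at once costs nothing (`measure_biUnion_le_of_antitone`). Thus no
complexity term in `t` is needed. -/

lemma treeLoss_nonneg (T : DecisionTree 𝒳 (Fin c)) (D : Dataset 𝒳 c n) : 0 ≤ treeLoss T D :=
  mul_nonneg (by positivity) (Finset.sum_nonneg fun i _ => by split_ifs <;> norm_num)

lemma treeLoss_le_one (T : DecisionTree 𝒳 (Fin c)) (D : Dataset 𝒳 c n) : treeLoss T D ≤ 1 := by
  have h : (∑ i : Fin n, if T.predict (D i).1 ≠ (D i).2 then (1 : ℝ) else 0) ≤ n := by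
    calc _ ≤ ∑ _i : Fin n, (1 : ℝ) := Finset.sum_le_sum fun i _ => by split_ifs <;> norm_num
      _ = n := by simp
  unfold treeLoss
  rw [one_div, inv_mul_eq_div]
  exact div_le_one_of_le₀ h (Nat.cast_nonneg n)

/-- The training loss of minimum cost-complexity pruning is nondecreasing in the parameter. -/
lemma IsMinCostComplexityPruning.treeLoss_mono
    {prune : ℝ → DecisionTree 𝒳 (Fin c) → Dataset 𝒳 c n → DecisionTree 𝒳 (Fin c)}
    (h : IsMinCostComplexityPruning prune) (T : DecisionTree 𝒳 (Fin c)) (D : Dataset 𝒳 c n)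
    {α β : ℝ} (hα : 0 ≤ α) (hαβ : α ≤ β) :
    treeLoss (prune α T D) D ≤ treeLoss (prune β T D) D := by
  rcases hαβ.eq_or_lt with rfl | hlt
  · exact le_rfl
  have h₁ := (h α hα T D).2 _ (h β (hα.trans hαβ) T D).1
  have h₂ := (h β (hα.trans hαβ) T D).2 _ (h α hα T D).1
  unfold costComplexity at h₁ h₂
  -- Adding `h₁` and `h₂` cancels the losses and leaves `β - α` times the difference in leaves.
  have hleaves : ((prune β T D).numLeaves : ℝ) ≤ (prune α T D).numLeaves := by
    by_contra! hcon
    nlinarith [mul_pos (sub_pos.2 hlt) (sub_pos.2 hcon)]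
  nlinarith [mul_nonneg hα (sub_nonneg.2 hleaves)]

end CostComplexity

section MonotoneLoss

/-- An upward directed union of sets indexed by reals, increasing as the index decreases, is
measured by countably many of them. -/
lemma measure_biUnion_le_of_antitone {Ω : Type*} [MeasurableSpace Ω] (ν : Measure Ω)
    {B : Set ℝ} (hB : BddBelow B) {A : ℝ → Set Ω}
    (hA : ∀ α ∈ B, ∀ β ∈ B, α ≤ β → A β ⊆ A α) {b : ENNReal} (hb : ∀ α ∈ B, ν (A α) ≤ b) :
    ν (⋃ α ∈ B, A α) ≤ b := by
  rcases B.eq_empty_or_nonempty with rfl | hne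
  · simp
  by_cases hmem : sInf B ∈ B
  · refine (measure_mono ?_).trans (hb _ hmem)
    exact Set.iUnion₂_subset fun α hα => hA _ hmem _ hα (csInf_le hB hα)
  -- The infimum is not attained: a sequence in `B` decreasing to it gives increasing sets, and
  -- continuity from below for these needs no measurability.
  obtain ⟨u, hu, hlim, huB⟩ := exists_seq_tendsto_sInf hne hB
  have hsub : (⋃ α ∈ B, A α) ⊆ ⋃ k, A (u k) := by
    refine Set.iUnion₂_subset fun α hα => ?_
    have hlt : sInf B < α := (csInf_le hB hα).lt_of_ne fun h => hmem (h ▸ hα)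
    obtain ⟨k, hk⟩ := (hlim.eventually_lt_const hlt).exists
    exact (hA _ (huB k) _ hα hk.le).trans (Set.subset_iUnion (fun k => A (u k)) k)
  refine (measure_mono hsub).trans ?_
  have hmono : Monotone fun k => A (u k) := fun i j hij => hA _ (huB j) _ (huB i) (hu hij)
  rw [hmono.measure_iUnion]
  exact iSup_le fun k => hb _ (huB k)

variable {Ω : Type*} [MeasurableSpace Ω] {μ : Measure Ω} [IsProbabilityMeasure μ]

/-- The difference `f - g` vanishes where the functions agree and is at most `1` elsewhere, so its
mean bounds the probability of disagreement from below. -/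
lemma measure_eq_le_of_lt_integral {f g : Ω → ℝ} (hf : Measurable f) (hg : Measurable g)
    (hf₁ : ∀ x, f x ≤ 1) (hg₀ : ∀ x, 0 ≤ g x) (hgf : ∀ x, g x ≤ f x)
    {ε : ℝ} (h : ∫ x, g x ∂μ + ε < ∫ x, f x ∂μ) :
    μ {x | f x = g x} ≤ ENNReal.ofReal (1 - ε) := by
  have hfi : Integrable f μ := Integrable.of_mem_Icc 0 1 hf.aemeasurable
    (.of_forall fun x => ⟨(hg₀ x).trans (hgf x), hf₁ x⟩)
  have hgi : Integrable g μ := Integrable.of_mem_Icc 0 1 hg.aemeasurable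
    (.of_forall fun x => ⟨hg₀ x, (hgf x).trans (hf₁ x)⟩)
  have hms : MeasurableSet {x | f x = g x} := measurableSet_eq_fun hf hg
  have hle : ∫ x, (f x - g x) ∂μ ≤ ∫ x, {x | f x = g x}ᶜ.indicator 1 x ∂μ := by
    refine integral_mono (hfi.sub hgi) ((integrable_const (1 : ℝ)).indicator hms.compl) fun x => ?_
    by_cases hx : f x = g x
    · simp [hx]
    · simp only [Set.indicator, Set.mem_compl_iff, Set.mem_ofPred_eq, hx, not_false_eq_true,
        if_true, Pi.one_apply]
      linarith [hf₁ x, hg₀ x]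
  rw [integral_sub hfi hgi, integral_indicator_one hms.compl, probReal_compl_eq_one_sub hms] at hle
  rw [← ofReal_measureReal]
  exact ENNReal.ofReal_le_ofReal (by linarith)

/-- Empirical risk minimization over `[0, ∞)` for a `[0, 1]`-valued loss that is nondecreasing in
the parameter: all minimizers are `ε`-optimal, except with probability at most `(1 - ε) ^ N`. -/
lemma measure_not_isEpsOptimal_le {ℓ : ℝ → Ω → ℝ} (hmeas : ∀ α, 0 ≤ α → Measurable (ℓ α))
    (h₀ : ∀ α x, 0 ≤ ℓ α x) (h₁ : ∀ α x, ℓ α x ≤ 1)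
    (hmono : ∀ α β x, 0 ≤ α → α ≤ β → ℓ α x ≤ ℓ β x) (ε : ℝ) (N : ℕ) :
    (Measure.pi fun _ : Fin N => μ)
        {S | ¬ ∀ α : ℝ, IsERM ℓ S α → IsEpsOptimal ℓ μ ε α} ≤ ENNReal.ofReal (1 - ε) ^ N := by
  set B : Set ℝ := {α | 0 ≤ α ∧ ∫ x, ℓ 0 x ∂μ + ε < ∫ x, ℓ α x ∂μ} with hBdef
  set A : ℝ → Set (Fin N → Ω) := fun α => Set.univ.pi fun _ => {x | ℓ α x = ℓ 0 x} with hAdef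
  have hint : ∀ α, 0 ≤ α → Integrable (ℓ α) μ := fun α hα =>
    Integrable.of_mem_Icc 0 1 (hmeas α hα).aemeasurable (.of_forall fun x => ⟨h₀ α x, h₁ α x⟩)
  have hsub : {S | ¬ ∀ α : ℝ, IsERM ℓ S α → IsEpsOptimal ℓ μ ε α} ⊆ ⋃ α ∈ B, A α := by
    intro S hS
    simp only [Set.mem_ofPred_eq, IsEpsOptimal] at hS
    push Not at hS
    obtain ⟨α, ⟨hα, herm⟩, α', hα', hlt⟩ := hS
    -- It suffices to compare with the parameter `0`, whose expected loss is least.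
    have hle : ∫ x, ℓ 0 x ∂μ ≤ ∫ x, ℓ α' x ∂μ :=
      integral_mono (hint 0 le_rfl) (hint α' hα') fun x => hmono 0 α' x le_rfl hα'
    refine Set.mem_iUnion₂.2 ⟨α, ⟨hα, by linarith⟩, fun j _ => ?_⟩
    have hj : ∀ j ∈ Finset.univ, ℓ 0 (S j) ≤ ℓ α (S j) := fun j _ => hmono 0 α _ le_rfl hα
    -- Equal sums of termwise ordered losses force equality on each sample.
    exact ((Finset.sum_eq_sum_iff_of_le hj).1
      (le_antisymm (Finset.sum_le_sum hj) (herm 0 le_rfl)) j (Finset.mem_univ j)).symm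
  refine (measure_mono hsub).trans (measure_biUnion_le_of_antitone _ ⟨0, fun α hα => hα.1⟩ ?_ ?_)
  · intro α hα β _ hαβ S hS j hj
    exact le_antisymm ((hmono α β _ hα.1 hαβ).trans (hS j hj).le) (hmono 0 α _ le_rfl hα.1)
  · intro α hα
    rw [hAdef, Measure.pi_pi, Finset.prod_const, Finset.card_univ, Fintype.card_fin]
    exact pow_le_pow_left' (measure_eq_le_of_lt_integral (hmeas α hα.1) (hmeas 0 le_rfl) (h₁ α)
      (h₀ 0) (fun x => hmono 0 α x le_rfl hα.1) hα.2) N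

lemma one_sub_pow_le_of_sample_size {ε δ : ℝ} (hε : 0 < ε) (hδ : 0 < δ) {N : ℕ}
    (hN : 1 / ε ^ 2 * Real.log (1 / δ) ≤ N) (hε₁ : ε ≤ 1) : (1 - ε) ^ N ≤ δ := by
  have hlog : Real.log (1 / δ) ≤ N * ε := by
    rw [one_div_mul_eq_div, div_le_iff₀ (by positivity)] at hN
    refine hN.trans (mul_le_mul_of_nonneg_left ?_ (Nat.cast_nonneg N))
    -- This is `ε ^ 2 ≤ ε`; a sample size of order `1 / ε` would already do.
    nlinarith
  calc (1 - ε) ^ N ≤ Real.exp (-ε) ^ N :=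
        pow_le_pow_left₀ (by linarith) (Real.one_sub_le_exp_neg ε) N
    _ = Real.exp (-(N * ε)) := by rw [← Real.exp_nat_mul]; ring_nf
    _ ≤ Real.exp (Real.log δ) := by
        rw [one_div, Real.log_inv] at hlog
        exact Real.exp_le_exp.2 (by linarith)
    _ = δ := Real.exp_log hδ

end MonotoneLoss



theorem mainTheorem5 :
    ∃ C : ℝ, 0 < C ∧
      ∀ (𝒳 : Type*) [MeasurableSpace 𝒳] (c n t : ℕ) (_ht : 1 ≤ t)
        (unpruned : Dataset 𝒳 c n → DecisionTree 𝒳 (Fin c))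
        (_hsize : ∀ D, (unpruned D).size ≤ t)
        (prune : ℝ → DecisionTree 𝒳 (Fin c) → Dataset 𝒳 c n → DecisionTree 𝒳 (Fin c))
        (_hprune : IsMinCostComplexityPruning prune)
        (_hmeas : ∀ α : ℝ, 0 ≤ α →
          Measurable fun D : Dataset 𝒳 c n => treeLoss (prune α (unpruned D) D) D)
        (μ : Measure (Dataset 𝒳 c n)) [IsProbabilityMeasure μ]
        (ε δ : ℝ) (_hε : 0 < ε) (_hδ : 0 < δ)
        (N : ℕ) (_hN : C * (1 / ε ^ 2 * (Real.log t + Real.log (1 / δ))) ≤ N),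
        (Measure.pi fun _ : Fin N => μ)
            {S | ¬ ∀ αhat : ℝ,
              IsERM (fun α D => treeLoss (prune α (unpruned D) D) D) S αhat →
                IsEpsOptimal (fun α D => treeLoss (prune α (unpruned D) D) D) μ ε αhat}
          ≤ ENNReal.ofReal δ := by
  refine ⟨1, one_pos, ?_⟩
  intro 𝒳 _ c n t ht unpruned _ prune hprune hmeas μ _ ε δ hε hδ N hN
  have hmono : ∀ α β (D : Dataset 𝒳 c n), 0 ≤ α → α ≤ β →
      treeLoss (prune α (unpruned D) D) D ≤ treeLoss (prune β (unpruned D) D) D :=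
    fun α β D hα hαβ => hprune.treeLoss_mono _ D hα hαβ
  rcases le_or_gt ε 1 with hε₁ | hε₁
  · refine (measure_not_isEpsOptimal_le hmeas (fun _ _ => treeLoss_nonneg _ _)
      (fun _ _ => treeLoss_le_one _ _) hmono ε N).trans ?_
    rw [← ENNReal.ofReal_pow (by linarith)]
    refine ENNReal.ofReal_le_ofReal (one_sub_pow_le_of_sample_size hε hδ (le_trans ?_ hN) hε₁)
    rw [one_mul]
    -- The `log t` term is nonnegative and is simply dropped.
    have ht₀ : 0 ≤ Real.log t := Real.log_nonneg (by exact_mod_cast ht)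
    exact mul_le_mul_of_nonneg_left (by linarith) (by positivity)
  -- For `ε > 1` nothing can fail, since expected losses lie in `[0, 1]`.
  · have hempty : {S : Fin N → Dataset 𝒳 c n | ¬ ∀ αhat : ℝ,
        IsERM (fun α D => treeLoss (prune α (unpruned D) D) D) S αhat →
          IsEpsOptimal (fun α D => treeLoss (prune α (unpruned D) D) D) μ ε αhat} = ∅ := by
      refine Set.eq_empty_iff_forall_notMem.2 fun S hS => hS fun α hα α' _ => ?_
      have hle : ∫ D, treeLoss (prune α (unpruned D) D) D ∂μ ≤ ∫ _, (1 : ℝ) ∂μ :=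
        integral_mono (Integrable.of_mem_Icc 0 1 (hmeas α hα.1).aemeasurable
          (.of_forall fun D => ⟨treeLoss_nonneg _ _, treeLoss_le_one _ _⟩))
          (integrable_const 1) fun D => treeLoss_le_one _ _
      have hnn : 0 ≤ ∫ D, treeLoss (prune α' (unpruned D) D) D ∂μ :=
        integral_nonneg fun D => treeLoss_nonneg _ _
      simp only [integral_const, probReal_univ, smul_eq_mul, mul_one] at hle
      exact hle.trans (by linarith)
    rw [hempty, measure_empty]
    exact zero_le
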